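/- Let $a$ and $b$ be positive integers with $\gcd(a,b)=1$, and let $p(z)=a_Dz^D+\dots+a_1z\in\mathbb{Z}[z]$ (with zero constant term) satisfy $D\ge 2$, $a_D>0$ and $a_1\neq 0$. Then the equation $ax+by=p(z)$ is $2$-Ramsey; that is, for every colouring of the positive integers with two colours there are infinitely many triples $(x,y,z)$ of positive integers with $ax+by=p(z)$ such that $x$, $y$ and $z$ all have the same colour. -/

import Mathlib

/-- The equation `a x + b y = p(z)` is `k`-Ramsey: every colouring of the positive integers with
`k` colours admits infinitely many monochromatic solutions `(x, y, z)` in positive integers. -/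
def IsRamseyEquation (k a b : ℕ) (p : Polynomial ℤ) : Prop :=
  ∀ φ : ℕ+ → Fin k,
    {s : ℕ+ × ℕ+ × ℕ+ |
      (a : ℤ) * (s.1 : ℤ) + (b : ℤ) * (s.2.1 : ℤ) = p.eval (s.2.2 : ℤ) ∧
        φ s.1 = φ s.2.1 ∧ φ s.2.1 = φ s.2.2}.Infinite

/-!
With `q z = p (a b z) / (a b)`, a solution of `x + y = q z` yields the solution `(b x, a y, a b z)`
of `a x + b y = p z`. So let `f x`, `h y`, `c z` be the colours of `b x`, `a y`, `a b z`; these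
satisfy `f (a z) = h (b z) = c z`. Suppose that for `z ≥ M` the equation `x + y = q z` has no
solution with `f x = h y = c z`.

If `c z ≠ c w`, reflecting first in `q w` and then in `q z` shows that the class of `f` (and of `h`)
with the colour of `w` is preserved by the shift by `q z - q w` (`SolutionFree.shift`).

* A colour change and the change back, `z < w < z'` with `c z = c z' ≠ c w`, give shifts in both
  directions, hence a common period of `f` and `h` on `[1, q z - 1]`
  (`SolutionFree.exists_period`).
* A colour change with long monochromatic stretches on both sides is impossible: the shifts by
  `q (z + j) - q z` all go in one direction, but their sums approximate every large integer up to
  a bounded error (`exists_mem_incrementMonoid_near`, by finite differences of `q`), and some sum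
  leads from `a (z - i)` to `q z - b (z - j)` (`SolutionFree.exists_run_bound`).

As `c` is not eventually constant, there are far out changes back and forth at bounded distance.
They produce a period `g` of size `O (z ^ (D - 1))` with range of order `z ^ D`, where `D = deg q`.
Then `c` is itself periodic at a much larger scale, so that the first point applies again, to
`z = g k`, `z' = g (k + i)` and an element `w` of a class modulo `g` whose colour differs from that
of the multiples of `g`. The resulting period divides `q (g (k + i)) - q (g k)` for all `i ≤ D`. By
a Vandermonde determinant it divides a constant multiple of `q₁ g` (`exists_dvd_coeff_one`), and
`q₁ = p₁ ≠ 0`. So there is a period `d = O (g)` whose range has order at least `g ^ D`, with a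
constant that may be taken large. Then multiples of `d` provide a monochromatic solution, because
`d ∣ z` implies `d ∣ q z` (`SolutionFree.exists_eq_of_period`).
-/

namespace LinearPolynomialRamsey

/-! ### Colourings without monochromatic solutions, and the shifts they respect -/

/-- There is no solution of `x + y = q z` in positive integers with `z ≥ M` for which `x`, `y`, `z`,
coloured by `f`, `h`, `c` respectively, receive the same colour. -/
def SolutionFree (q : ℤ → ℤ) (M : ℤ) (f h c : ℤ → Bool) : Prop :=
  ∀ x y z, 0 < x → 0 < y → M ≤ z → x + y = q z → f x = c z → h y = c z → False

lemma SolutionFree.symm {q : ℤ → ℤ} {M : ℤ} {f h c : ℤ → Bool} (H : SolutionFree q M f h c) :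
    SolutionFree q M h f c :=
  fun x y z hx hy hz hq hf hh => H y x z hy hx hz (by rw [add_comm, hq]) hh hf

/-- If `z` and `w` have different colours, then the class of `f` with the colour of `w` is carried
into itself by the shift by `q z - q w`: reflect in `q w`, which changes the colour, and then in
`q z`, which changes it back. -/
lemma SolutionFree.shift {q : ℤ → ℤ} {M : ℤ} {f h c : ℤ → Bool} (H : SolutionFree q M f h c)
    {z w x : ℤ} (hz : M ≤ z) (hw : M ≤ w) (hzw : c z ≠ c w) (hx : 0 < x) (hxw : x < q w)
    (hx' : 0 < x - q w + q z) (hf : f x = c w) : f (x - q w + q z) = c w := by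
  have h1 : h (q w - x) ≠ c w := fun hh => H x (q w - x) w hx (by linarith) hw (by ring) hf hh
  have h2 : h (q w - x) = c z := by
    revert h1 hzw; cases h (q w - x) <;> cases c z <;> cases c w <;> simp
  have h3 : f (x - q w + q z) ≠ c z := fun hh =>
    H (x - q w + q z) (q w - x) z hx' (by linarith) hz (by ring) hh h2
  revert h3 hzw; cases f (x - q w + q z) <;> cases c z <;> cases c w <;> simp

/-! ### Periods on an initial interval -/

/-- `f` has period `n` on the interval `[1, R]`. -/
def PeriodicUpTo {α : Type*} (f : ℤ → α) (R n : ℤ) : Prop :=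
  ∀ x, 0 < x → x + n ≤ R → f x = f (x + n)

lemma PeriodicUpTo.mul {α : Type*} {f : ℤ → α} {R n : ℤ} (hn : 0 ≤ n) (H : PeriodicUpTo f R n)
    (k : ℕ) : PeriodicUpTo f R (k * n) := by
  induction k with
  | zero => intro x _ _; simp
  | succ k ih =>
    intro x hx hR
    push_cast at hR ⊢
    have hk : 0 ≤ (k : ℤ) * n := by positivity
    rw [ih x hx (by linarith), H (x + k * n) (by linarith) (by linarith)]
    congr 1; ring

lemma PeriodicUpTo.eq_of_dvd {α : Type*} {f : ℤ → α} {R n : ℤ} (hn : 0 < n)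
    (H : PeriodicUpTo f R n) {x y : ℤ} (hx : 0 < x) (hy : 0 < y) (hxR : x ≤ R) (hyR : y ≤ R)
    (hd : n ∣ y - x) : f x = f y := by
  wlog hxy : x ≤ y generalizing x y
  · exact (this hy hx hyR hxR (by rw [← neg_sub]; exact hd.neg_right) (by linarith)).symm
  obtain ⟨k, hk⟩ := hd
  have hk0 : 0 ≤ k := by
    by_contra hneg
    nlinarith
  lift k to ℕ using hk0
  have := H.mul hn.le k x hx (by linarith)
  rw [this]; congr 1; linarith

/-- Two periods whose sum fits into the interval have a period as their greatest common divisor: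
this is Euclid's algorithm, as `x + n` or `x - m` lies in the interval. -/
lemma PeriodicUpTo.gcd {α : Type*} {f : ℤ → α} {R : ℤ} {m n : ℕ}
    (hm : PeriodicUpTo f R m) (hn : PeriodicUpTo f R n) (hR : (m : ℤ) + n ≤ R) :
    PeriodicUpTo f R (Nat.gcd m n) := by
  induction hs : m + n using Nat.strong_induction_on generalizing m n with
  | _ s ih =>
    wlog hmn : m ≤ n generalizing m n
    · rw [Nat.gcd_comm]
      exact this hn hm (by linarith) (by omega) (by omega)
    rcases Nat.eq_zero_or_pos m with rfl | hm0
    · simpa using hn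
    have hsub : PeriodicUpTo f R ((n - m : ℕ) : ℤ) := by
      intro x hx hxR
      push_cast [hmn] at hxR ⊢
      by_cases hc : x + n ≤ R
      · rw [hn x hx hc, hm (x + (n - m)) (by omega) (by omega)]
        congr 1; ring
      · have h1 := hm (x - m) (by omega) (by omega)
        rw [sub_add_cancel] at h1
        rw [← h1, hn (x - m) (by omega) (by omega)]
        congr 1; ring
    have := ih (m + (n - m)) (by omega) hm hsub (by omega) rfl
    rwa [Nat.gcd_sub_self_right hmn] at this

/-- A class which is carried into itself by the shifts by `-d` and by `e` within `[1, R]` is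
periodic with period `gcd d e` there. In a window of length `d + e` the two shifts make up the
rotation by `e` modulo `d + e`, whose orbits are the residue classes modulo `gcd d e`. -/
lemma periodicUpTo_gcd_of_shifts {f : ℤ → Bool} {β : Bool} {R : ℤ} {d e : ℕ} (hd : 0 < d)
    (he : 0 < e) (hR : (d : ℤ) + e ≤ R)
    (hdown : ∀ x, x ≤ R → 0 < x - d → f x = β → f (x - d) = β)
    (hup : ∀ x, 0 < x → x + e ≤ R → f x = β → f (x + e) = β) :
    PeriodicUpTo f R (Nat.gcd d e) := by
  set N : ℤ := d + e with hN
  have hNpos : 0 < N := by omega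
  have walk : ∀ o : ℤ, 0 ≤ o → o + N ≤ R → ∀ r : ℤ, 0 ≤ r → r < N → f (o + 1 + r) = β →
      ∀ n : ℕ, f (o + 1 + (r + n * e) % N) = β := by
    intro o ho hoR r hr hrN hf n
    induction n with
    | zero => simpa [Int.emod_eq_of_lt hr hrN] using hf
    | succ n ih =>
      have h1 : (r + (n + 1 : ℕ) * e) % N = ((r + n * e) % N + e) % N := by
        rw [Int.emod_add_emod]; push_cast; congr 1; ring
      rw [h1]
      have hr0 := Int.emod_nonneg (r + n * e) hNpos.ne'
      have hr1 := Int.emod_lt_of_pos (r + n * e) hNpos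
      generalize (r + n * e) % N = u at *
      by_cases hu : u < d
      · rw [Int.emod_eq_of_lt (by omega) (by omega), ← add_assoc]
        exact hup _ (by omega) (by omega) ih
      · have h2 : (u + e) % N = u - d := by
          rw [show u + (e : ℤ) = (u - d) + N by rw [hN]; ring, Int.add_emod_right,
            Int.emod_eq_of_lt (by omega) (by omega)]
        rw [h2, ← add_sub_assoc]
        exact hdown _ (by omega) (by omega) ih
  -- every multiple of the gcd is a nonnegative multiple of `e` modulo `d + e`
  have reach : ∀ t : ℤ, (Nat.gcd d e : ℤ) ∣ t → ∃ n : ℕ, ∃ m : ℤ, (n : ℤ) * e = t + N * m := by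
    rintro t ⟨k, rfl⟩
    have hb := Nat.gcd_eq_gcd_ab d e
    set u := d.gcdA e
    set v := d.gcdB e
    have hnn := Int.emod_nonneg (k * (v - u)) hNpos.ne'
    refine ⟨(k * (v - u) % N).toNat, -(k * u) - e * (k * (v - u) / N), ?_⟩
    rw [Int.toNat_of_nonneg hnn, hb, Int.emod_def]
    rw [hN]; ring
  have move : ∀ o : ℤ, 0 ≤ o → o + N ≤ R → ∀ r r' : ℤ, 0 ≤ r → r < N → 0 ≤ r' → r' < N →
      (Nat.gcd d e : ℤ) ∣ r' - r → f (o + 1 + r) = β → f (o + 1 + r') = β := by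
    intro o ho hoR r r' hr hrN hr' hrN' hdvd hf
    obtain ⟨n, m, hnm⟩ := reach _ hdvd
    have := walk o ho hoR r hr hrN hf n
    rwa [hnm, show r + (r' - r + N * m) = r' + N * m by ring, Int.add_mul_emod_self_left,
      Int.emod_eq_of_lt hr' hrN'] at this
  intro x hx hxR
  have hg : (Nat.gcd d e : ℤ) ≤ d := by exact_mod_cast Nat.gcd_le_left e hd
  obtain ⟨o, ho0, hoR, hox, hxo⟩ : ∃ o : ℤ, 0 ≤ o ∧ o + N ≤ R ∧ o + 1 ≤ x ∧
      x + (Nat.gcd d e : ℤ) ≤ o + N :=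
    ⟨min (x - 1) (R - N), by omega, by omega, by omega, by omega⟩
  set g : ℤ := ((Nat.gcd d e : ℕ) : ℤ)
  have hg0 : 0 ≤ g := by positivity
  have key : f x = β ↔ f (x + g) = β := by
    have e1 : o + 1 + (x - o - 1) = x := by ring
    have e2 : o + 1 + (x + g - o - 1) = x + g := by ring
    constructor
    · intro hf
      have := move o ho0 hoR (x - o - 1) (x + g - o - 1) (by omega) (by omega) (by omega)
        (by omega) ⟨1, by ring⟩ (by rwa [e1])
      rwa [e2] at this
    · intro hf
      have := move o ho0 hoR (x + g - o - 1) (x - o - 1) (by omega) (by omega) (by omega)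
        (by omega) ⟨-1, by ring⟩ (by rwa [e2])
      rwa [e1] at this
  revert key; cases f x <;> cases f (x + g) <;> cases β <;> simp

/-- A colour change and the change back at `z < w < z'` make `f` periodic up to `q z`. -/
lemma SolutionFree.periodicUpTo {q : ℤ → ℤ} {M : ℤ} {f h c : ℤ → Bool}
    (H : SolutionFree q M f h c) {z w z' : ℤ} (hz : M ≤ z) (hw : M ≤ w) (hz' : M ≤ z')
    (hzw : q z < q w) (hwz' : q w < q z') (hc : c z = c z') (hcw : c z ≠ c w)
    (hR : q z' - q z < q z) :
    PeriodicUpTo f (q z - 1) (Nat.gcd (q w - q z).toNat (q z' - q w).toNat) := by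
  have hd : ((q w - q z).toNat : ℤ) = q w - q z := Int.toNat_of_nonneg (by linarith)
  have he : ((q z' - q w).toNat : ℤ) = q z' - q w := Int.toNat_of_nonneg (by linarith)
  refine periodicUpTo_gcd_of_shifts (β := c w) (by omega) (by omega) (by omega) ?_ ?_
  · intro x hx hx' hf
    rw [hd] at hx' ⊢
    have := H.shift hz hw hcw (by linarith) (by linarith) (by linarith) hf
    rwa [show x - q w + q z = x - (q w - q z) by ring] at this
  · intro x hx hx' hf
    rw [he] at hx' ⊢
    have := H.shift hz' hw (hc ▸ hcw) hx (by linarith) (by linarith) hf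
    rwa [show x - q w + q z' = x + (q z' - q w) by ring] at this

/-- The same period serves for `f` and `h`. -/
lemma SolutionFree.exists_period {q : ℤ → ℤ} {M : ℤ} {f h c : ℤ → Bool}
    (H : SolutionFree q M f h c) {z w z' : ℤ} (hz : M ≤ z) (hw : M ≤ w) (hz' : M ≤ z')
    (hzw : q z < q w) (hwz' : q w < q z') (hc : c z = c z') (hcw : c z ≠ c w)
    (hR : q z' - q z < q z) :
    ∃ p : ℕ, 0 < p ∧ (p : ℤ) ≤ q z' - q z ∧ (p : ℤ) ∣ q z' - q z ∧
      PeriodicUpTo (fun x => (f x, h x)) (q z - 1) p := by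
  refine ⟨Nat.gcd (q w - q z).toNat (q z' - q w).toNat, Nat.gcd_pos_of_pos_left _ (by omega),
    ?_, ?_, fun x hx hxR => ?_⟩
  · have : Nat.gcd (q w - q z).toNat (q z' - q w).toNat ≤ (q w - q z).toNat :=
      Nat.gcd_le_left _ (by omega)
    omega
  · have h1 : (Nat.gcd (q w - q z).toNat (q z' - q w).toNat : ℤ) ∣ ((q w - q z).toNat : ℤ) := by
      exact_mod_cast Nat.gcd_dvd_left _ _
    have h2 : (Nat.gcd (q w - q z).toNat (q z' - q w).toNat : ℤ) ∣ ((q z' - q w).toNat : ℤ) := by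
      exact_mod_cast Nat.gcd_dvd_right _ _
    rw [Int.toNat_of_nonneg (by linarith)] at h1 h2
    have := dvd_add h1 h2
    rwa [show q w - q z + (q z' - q w) = q z' - q z by ring] at this
  · exact Prod.ext (H.periodicUpTo hz hw hz' hzw hwz' hc hcw hR x hx hxR)
      (H.symm.periodicUpTo hz hw hz' hzw hwz' hc hcw hR x hx hxR)

/-- Finitely many periods which are small against the interval have a common divisor that is again
a period. -/
lemma exists_common_period {α : Type*} {f : ℤ → α} {R E : ℤ} (hE : 2 * E ≤ R)
    (F : ℕ → ℤ) (n : ℕ) (hn : 0 < n)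
    (hF : ∀ i < n, ∃ p : ℕ, 0 < p ∧ (p : ℤ) ≤ E ∧ (p : ℤ) ∣ F i ∧ PeriodicUpTo f R p) :
    ∃ p : ℕ, 0 < p ∧ (∀ i < n, (p : ℤ) ∣ F i) ∧ PeriodicUpTo f R p := by
  suffices ∃ p : ℕ, 0 < p ∧ (p : ℤ) ≤ E ∧ (∀ i < n, (p : ℤ) ∣ F i) ∧ PeriodicUpTo f R p by
    obtain ⟨p, h0, -, h1, h2⟩ := this
    exact ⟨p, h0, h1, h2⟩
  induction n, hn using Nat.le_induction with
  | base =>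
    obtain ⟨p, h0, h1, h2, h3⟩ := hF 0 (by simp)
    refine ⟨p, h0, h1, fun i hi => ?_, h3⟩
    obtain rfl : i = 0 := by omega
    exact h2
  | succ n hn ih =>
    obtain ⟨p, h0, h1, h2, h3⟩ := ih fun i hi => hF i (by omega)
    obtain ⟨r, k0, k1, k2, k3⟩ := hF n (by omega)
    have hp : (Nat.gcd p r : ℤ) ∣ p := by exact_mod_cast Nat.gcd_dvd_left p r
    have hr : (Nat.gcd p r : ℤ) ∣ r := by exact_mod_cast Nat.gcd_dvd_right p r
    refine ⟨Nat.gcd p r, Nat.gcd_pos_of_pos_left _ h0, ?_, fun i hi => ?_,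
      h3.gcd k3 (by linarith)⟩
    · exact (Int.le_of_dvd (by exact_mod_cast h0) hp).trans h1
    · rcases Nat.lt_succ_iff_lt_or_eq.1 hi with hi | rfl
      · exact hp.trans (h2 i hi)
      · exact hr.trans k2

open Polynomial Filter

/-! ### Integer polynomials: growth and divisibility of values -/

lemma eventually_eval_pos {p : ℤ[X]} {m : ℕ} (hdeg : p.natDegree ≤ m) (hm : 0 < p.coeff m) :
    ∀ᶠ z : ℤ in atTop, 0 < p.eval z := by
  have hnat : p.natDegree = m := le_antisymm hdeg (le_natDegree_of_ne_zero hm.ne')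
  rcases Nat.eq_zero_or_pos m with rfl | hm0
  · rw [eq_C_of_natDegree_eq_zero hnat]
    simp only [eval_C]
    exact Eventually.of_forall fun _ => hm
  have hinj : Function.Injective (Int.castRingHom ℝ) := Int.cast_injective
  have hd : (p.map (Int.castRingHom ℝ)).natDegree = m := by
    rw [natDegree_map_eq_of_injective hinj, hnat]
  have hl : 0 ≤ (p.map (Int.castRingHom ℝ)).leadingCoeff := by
    rw [leadingCoeff, hd, coeff_map, eq_intCast]
    exact_mod_cast hm.le
  have ht := (tendsto_atTop_of_leadingCoeff_nonneg _
    (natDegree_pos_iff_degree_pos.1 (hd ▸ hm0)) hl).comp (tendsto_intCast_atTop_atTop (R := ℝ))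
  filter_upwards [ht.eventually_gt_atTop 0] with z hz
  simp only [Function.comp_apply, eval_intCast_map, eq_intCast] at hz
  exact_mod_cast hz

lemma exists_eval_le (p : ℤ[X]) {m : ℕ} (hdeg : p.natDegree ≤ m) :
    ∃ C : ℤ, 0 < C ∧ ∀ᶠ z : ℤ in atTop, p.eval z ≤ C * z ^ m := by
  refine ⟨|p.coeff m| + 1, by positivity, ?_⟩
  have h : ∀ᶠ z : ℤ in atTop, 0 < (C (|p.coeff m| + 1) * X ^ m - p).eval z := by
    refine eventually_eval_pos (m := m) ?_ ?_
    · exact (natDegree_sub_le _ _).trans (max_le (natDegree_C_mul_X_pow_le _ _) hdeg)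
    · rw [coeff_sub, coeff_C_mul_X_pow, if_pos rfl]
      linarith [le_abs_self (p.coeff m)]
  filter_upwards [h] with z hz
  simp only [eval_sub, eval_mul, eval_C, eval_pow, eval_X] at hz
  linarith

lemma eventually_pow_le_two_mul {p : ℤ[X]} {m : ℕ} (hdeg : p.natDegree ≤ m) {a : ℤ}
    (hm : a ≤ p.coeff m) (ha : 0 < a) : ∀ᶠ z : ℤ in atTop, a * z ^ m < 2 * p.eval z := by
  have h : ∀ᶠ z : ℤ in atTop, 0 < (C 2 * p - C a * X ^ m).eval z := by
    refine eventually_eval_pos (m := m) ?_ ?_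
    · exact (natDegree_sub_le _ _).trans
        (max_le ((natDegree_C_mul_le _ _).trans hdeg) (natDegree_C_mul_X_pow_le _ _))
    · rw [coeff_sub, coeff_C_mul_X_pow, if_pos rfl, coeff_C_mul]
      linarith
  filter_upwards [h] with z hz
  simp only [eval_sub, eval_mul, eval_C, eval_pow, eval_X] at hz
  linarith

lemma exists_increment_bound (q : ℤ[X]) {D : ℕ} (hD : q.natDegree ≤ D) :
    ∃ L : ℤ, 0 < L ∧ ∀ n m : ℤ, 0 < n → 0 ≤ m →
      q.eval (n + m) - q.eval n ≤ L * m * (n + m) ^ (D - 1) := by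
  refine ⟨∑ j ∈ Finset.range (D + 1), |q.coeff j| * j + 1,
    add_pos_of_nonneg_of_pos (Finset.sum_nonneg fun _ _ => by positivity) one_pos, ?_⟩
  intro n m hn hm
  have h1 : q.eval (n + m) - q.eval n ≤
      ∑ j ∈ Finset.range (D + 1), |q.coeff j| * j * (m * (n + m) ^ (D - 1)) := by
    rw [eval_eq_sum_range' (Nat.lt_succ_of_le hD), eval_eq_sum_range' (Nat.lt_succ_of_le hD),
      ← Finset.sum_sub_distrib]
    refine Finset.sum_le_sum fun j hj => ?_
    have hj' : j ≤ D := Nat.lt_succ_iff.1 (Finset.mem_range.1 hj)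
    rw [← mul_sub]
    refine (le_abs_self _).trans ?_
    rw [abs_mul, mul_assoc]
    refine mul_le_mul_of_nonneg_left ?_ (abs_nonneg _)
    have h2 := abs_pow_sub_pow_le (n + m) n j
    rw [add_sub_cancel_left, abs_of_nonneg hm, abs_of_pos hn, abs_of_pos (by linarith : 0 < n + m),
      max_eq_left (by linarith)] at h2
    refine h2.trans ?_
    rw [mul_comm m, mul_assoc]
    gcongr
    · linarith
  rw [← Finset.sum_mul] at h1
  have h3 : 0 ≤ m * (n + m) ^ (D - 1) := by positivity
  nlinarith

/-- A relative increment of the argument which is small enough changes the value by an arbitrarily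
small proportion. -/
lemma exists_increment_lt_eval (q : ℤ[X]) (hlead : 0 < q.leadingCoeff) (hdeg : 0 < q.natDegree)
    (K : ℤ) (hK : 0 < K) :
    ∃ A : ℤ, 0 < A ∧ ∀ n m : ℤ, 0 ≤ m → A ≤ n → A * m ≤ n →
      K * (q.eval (n + m) - q.eval n) < q.eval n := by
  obtain ⟨L, hL, hLip⟩ := exists_increment_bound q le_rfl
  obtain ⟨N, hN⟩ := eventually_atTop.1
    (eventually_pow_le_two_mul (p := q) le_rfl (a := 1) hlead one_pos)
  set D := q.natDegree
  refine ⟨max N 0 + 2 ^ D * K * L + 1, by positivity, fun n m hm hn hnm => ?_⟩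
  have hA : 2 ^ D * K * L + 1 ≤ max N 0 + 2 ^ D * K * L + 1 := by
    linarith [le_max_right N 0]
  have hA0 : (0 : ℤ) ≤ 2 ^ D * K * L := by positivity
  have hn0 : 0 < n := by linarith [le_max_right N 0]
  have hq := hN n (by linarith [le_max_left N 0])
  have hmn : (2 ^ D * K * L) * m + m ≤ n := by nlinarith
  have hmn' : m ≤ n := by nlinarith [mul_nonneg hA0 hm]
  have h1 := hLip n m hn0 hm
  have h2 : (n + m) ^ (D - 1) ≤ (2 * n) ^ (D - 1) := pow_le_pow_left₀ (by linarith) (by linarith) _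
  have h3 : K * (q.eval (n + m) - q.eval n) ≤ K * (L * m * (2 * n) ^ (D - 1)) := by
    refine mul_le_mul_of_nonneg_left (h1.trans ?_) hK.le
    gcongr
  have h4 : 2 * (K * (L * m * (2 * n) ^ (D - 1))) = (2 ^ D * K * L) * m * n ^ (D - 1) := by
    obtain ⟨d, hd⟩ : ∃ d, D = d + 1 := ⟨D - 1, by omega⟩
    rw [hd, Nat.add_sub_cancel, mul_pow, pow_succ]; ring
  have h5 : n ^ D = n * n ^ (D - 1) := by
    rw [← pow_succ', Nat.sub_add_cancel hdeg]
  have h6 : (2 ^ D * K * L) * m * n ^ (D - 1) ≤ n * n ^ (D - 1) := by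
    gcongr
    linarith
  linarith

/-- If `m` divides the differences of the values of `q` at `D + 1` consecutive multiples of `g`,
where `D ≥ deg q`, then `m` divides `q₁ g` up to a factor depending only on `D`. By Cramer's rule
this factor may be taken to be the Vandermonde determinant of the points `0, 1, …, D`. -/
lemma exists_dvd_coeff_one (D : ℕ) (hD : 1 ≤ D) :
    ∃ C : ℤ, C ≠ 0 ∧ ∀ (q : ℤ[X]), q.natDegree ≤ D → ∀ m g k : ℤ,
      (∀ i ≤ D, m ∣ q.eval (g * (k + i)) - q.eval (g * k)) → m ∣ C * (q.coeff 1 * g) := by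
  let v : Fin (D + 1) → ℤ := fun i => (i : ℕ)
  refine ⟨(Matrix.vandermonde v).det, ?_, fun q hq m g k H => ?_⟩
  · refine Matrix.det_vandermonde_ne_zero_iff.2 fun i j hij => ?_
    simpa [v, Fin.ext_iff] using hij
  set G : ℤ[X] := q.comp (C g * X) - C (q.eval (g * k)) with hG
  have hGdeg : G.natDegree < D + 1 := by
    refine Nat.lt_succ_of_le ((natDegree_sub_le _ _).trans (max_le ?_ (by simp)))
    refine natDegree_comp_le.trans ?_
    calc q.natDegree * (C g * X).natDegree ≤ D * 1 :=
          Nat.mul_le_mul hq ((natDegree_C_mul_le g X).trans natDegree_X_le)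
      _ = D := mul_one D
  have hG1 : G.coeff 1 = q.coeff 1 * g := by
    rw [hG, coeff_sub, comp_C_mul_X_coeff, coeff_C, if_neg one_ne_zero, sub_zero, pow_one]
  have hval : ∀ i : Fin (D + 1), (Matrix.vandermonde (fun i => v i + k)).mulVec
      (fun j : Fin (D + 1) => G.coeff j) i = q.eval (g * (k + (i : ℕ))) - q.eval (g * k) := by
    intro i
    have : G.eval (v i + k) = q.eval (g * (k + (i : ℕ))) - q.eval (g * k) := by
      simp [hG, v, add_comm]
    rw [← this, eval_eq_sum_range' hGdeg, Finset.sum_range]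
    simp [Matrix.mulVec, dotProduct, Matrix.vandermonde_apply, mul_comm]
  have hadj : (Matrix.vandermonde v).det * G.coeff 1 =
      ((Matrix.vandermonde (fun i => v i + k)).adjugate.mulVec
        ((Matrix.vandermonde (fun i => v i + k)).mulVec
          (fun j : Fin (D + 1) => G.coeff j))) ⟨1, by omega⟩ := by
    rw [Matrix.mulVec_mulVec, Matrix.adjugate_mul, Matrix.det_vandermonde_add,
      Matrix.smul_mulVec, Matrix.one_mulVec]
    rfl
  rw [← hG1, hadj]
  rw [Matrix.mulVec, dotProduct]
  refine Finset.dvd_sum fun i _ => Dvd.dvd.mul_left ?_ _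
  rw [hval i]
  exact H i (by omega)

/-! ### Sums of increments approximate every large number -/

/-- The additive monoid generated by the increments `q (z + j) - q z` with `1 ≤ j ≤ J`. -/
def incrementMonoid (q : ℤ → ℤ) (J : ℕ) (z : ℤ) : AddSubmonoid ℤ :=
  AddSubmonoid.closure {d | ∃ j : ℕ, 0 < j ∧ j ≤ J ∧ d = q (z + j) - q z}

lemma increment_mem {q : ℤ → ℤ} {J j : ℕ} {z : ℤ} (hj : 0 < j) (hJ : j ≤ J) :
    q (z + j) - q z ∈ incrementMonoid q J z :=
  AddSubmonoid.subset_closure ⟨j, hj, hJ, rfl⟩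

lemma incrementMonoid_mono {q : ℤ → ℤ} {J J' : ℕ} {z : ℤ} (h : J ≤ J') :
    incrementMonoid q J z ≤ incrementMonoid q J' z :=
  AddSubmonoid.closure_mono fun _ ⟨j, h0, h1, h2⟩ => ⟨j, h0, h1.trans h, h2⟩

lemma mul_mem_of_nonneg {S : AddSubmonoid ℤ} {m x : ℤ} (hm : 0 ≤ m) (hx : x ∈ S) : m * x ∈ S := by
  lift m to ℕ using hm
  simpa using S.nsmul_mem hx m

/-- The forward difference of an integer polynomial with step `h`, as a polynomial. -/
noncomputable def diff (h : ℤ) (p : ℤ[X]) : ℤ[X] := taylor h p - p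

lemma eval_diff (h : ℤ) (p : ℤ[X]) (z : ℤ) : (diff h p).eval z = p.eval (z + h) - p.eval z := by
  rw [diff, eval_sub, taylor_eval]

lemma natDegree_diff_le {h : ℤ} {p : ℤ[X]} {m : ℕ} (hp : p.natDegree ≤ m + 1) :
    (diff h p).natDegree ≤ m := by
  refine natDegree_le_iff_coeff_eq_zero.2 fun n hn => ?_
  have hdeg : (hasseDeriv n p).natDegree ≤ 0 := (natDegree_hasseDeriv_le p n).trans (by omega)
  rw [diff, coeff_sub, taylor_coeff, eq_C_of_natDegree_le_zero hdeg, eval_C, hasseDeriv_coeff]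
  simp

lemma coeff_diff {h : ℤ} {p : ℤ[X]} {m : ℕ} (hp : p.natDegree ≤ m + 1) :
    (diff h p).coeff m = (m + 1) * h * p.coeff (m + 1) := by
  have hdeg : (hasseDeriv m p).natDegree < 2 := by
    have := natDegree_hasseDeriv_le p m
    omega
  rw [diff, coeff_sub, taylor_coeff, eval_eq_sum_range' hdeg]
  simp only [Finset.sum_range_succ, Finset.sum_range_zero, hasseDeriv_coeff]
  rw [show 1 + m = m + 1 by ring, Nat.choose_succ_self_right]
  simp
  ring

lemma natDegree_iterate_diff_le {h : ℤ} {q : ℤ[X]} {D : ℕ} (hq : q.natDegree ≤ D) :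
    ∀ n ≤ D, ((diff h)^[n] q).natDegree ≤ D - n
  | 0, _ => hq
  | n + 1, hn => by
    rw [Function.iterate_succ_apply']
    refine natDegree_diff_le ((natDegree_iterate_diff_le hq n (by omega)).trans (by omega))

lemma pow_le_coeff_iterate_diff {h : ℤ} (hh : 0 ≤ h) {q : ℤ[X]} {D : ℕ} (hq : q.natDegree ≤ D)
    (hlead : 0 < q.coeff D) : ∀ n ≤ D, h ^ n ≤ ((diff h)^[n] q).coeff (D - n)
  | 0, _ => by simpa using Int.add_one_le_iff.2 hlead
  | n + 1, hn => by
    have ih := pow_le_coeff_iterate_diff hh hq hlead n (by omega)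
    have hdeg := natDegree_iterate_diff_le (h := h) hq n (by omega)
    obtain ⟨m, rfl⟩ : ∃ m, D = m + n + 1 := ⟨D - n - 1, by omega⟩
    have e1 : m + n + 1 - n = m + 1 := by omega
    have e2 : m + n + 1 - (n + 1) = m := by omega
    rw [e1] at ih hdeg
    rw [e2, Function.iterate_succ_apply', coeff_diff hdeg, pow_succ, mul_assoc]
    have h0 : 0 ≤ h ^ n := by positivity
    have h1 : h ^ n * h ≤ h * ((diff h)^[n] q).coeff (m + 1) := by
      rw [mul_comm]; gcongr
    have h2 : 0 ≤ h * ((diff h)^[n] q).coeff (m + 1) := (by positivity : 0 ≤ h ^ n * h).trans h1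
    have h3 : 0 ≤ (m : ℤ) * (h * ((diff h)^[n] q).coeff (m + 1)) := by positivity
    linarith

lemma iterate_diff_sub_C (h c : ℤ) (q : ℤ[X]) (n : ℕ) :
    (diff h)^[n + 1] (q - C c) = (diff h)^[n + 1] q := by
  rw [Function.iterate_succ_apply, Function.iterate_succ_apply]
  rw [diff, diff, map_sub, taylor_C, sub_sub_sub_cancel_right]

/-- An iterated difference is a difference of two elements of the increment monoid of controlled
size. For `n = 0` this concerns the increment itself, whence the constant `q z`; it drops out for
positive `n`. -/
lemma exists_mem_sub_eq_iterate_diff (q : ℤ[X]) (h : ℕ) (z B : ℤ) (J : ℕ)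
    (hB : ∀ j ≤ J, q.eval (z + j) - q.eval z ≤ B) (n : ℕ) :
    ∀ o : ℕ, 0 < o → o + n * h ≤ J →
      ∃ s ∈ incrementMonoid q.eval J z, ∃ t ∈ incrementMonoid q.eval J z,
        s - t = ((diff h)^[n] (q - C (q.eval z))).eval (z + o) ∧
          s ≤ 2 ^ n * B ∧ t ≤ 2 ^ n * B := by
  induction n with
  | zero =>
    intro o ho hoJ
    refine ⟨_, increment_mem ho (by omega), 0, zero_mem _, by simp, ?_, ?_⟩
    · simpa using hB o (by omega)
    · simpa using hB 0 (by omega)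
  | succ n ih =>
    intro o ho hoJ
    rw [add_mul, one_mul] at hoJ
    obtain ⟨s, hs, t, ht, hst, hsB, htB⟩ := ih o ho (by omega)
    obtain ⟨s', hs', t', ht', hst', hsB', htB'⟩ := ih (o + h) (by omega) (by omega)
    refine ⟨s' + t, add_mem hs' ht, t' + s, add_mem ht' hs, ?_, ?_, ?_⟩
    · rw [Function.iterate_succ_apply', eval_diff, ← hst, add_assoc]
      push_cast at hst'
      rw [← hst']; ring
    · rw [pow_succ]; linarith
    · rw [pow_succ]; linarith

/-- Every integer `n` which is not small against `z ^ deg q` is approximated from below by the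
increment monoid at `z` up to `O (z ^ (deg q - k))`. In passing from `k` to `k + 1`, one reserves
`M` copies of a monoid element `t` for which `t` plus the `(k + 1)`-st difference of `q` is again
in the monoid; exchanging some of them corrects the error. For a long step `h` few copies are
needed. -/
lemma exists_mem_incrementMonoid_near {q : ℤ[X]} {D : ℕ} (hq : q.natDegree ≤ D)
    (hlead : 0 < q.coeff D) (k : ℕ) (hk : 1 ≤ k) :
    k ≤ D → ∀ E : ℤ, 0 < E → ∃ J : ℕ, ∃ C : ℤ, 0 < C ∧ ∀ᶠ z : ℤ in atTop, ∀ n : ℤ,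
      z ^ D ≤ E * n → ∃ s ∈ incrementMonoid q.eval J z, 0 ≤ n - s ∧ n - s ≤ C * z ^ (D - k) := by
  induction k, hk using Nat.le_induction with
  | base =>
    intro hD E hE
    have hdeg := natDegree_iterate_diff_le (h := 1) hq 1 hD
    have hco := pow_le_coeff_iterate_diff (h := 1) zero_le_one hq hlead 1 hD
    rw [Function.iterate_one] at hdeg hco
    obtain ⟨C, hC, hle⟩ := exists_eval_le _ hdeg
    refine ⟨1, C, hC, ?_⟩
    filter_upwards [hle, eventually_eval_pos hdeg (by linarith), eventually_ge_atTop 0]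
      with z hz hz0 hz1 n hn
    rw [eval_diff] at hz hz0
    have hn0 : 0 ≤ n := by
      have : 0 ≤ E * n := (pow_nonneg hz1 D).trans hn
      exact nonneg_of_mul_nonneg_right this hE
    refine ⟨n / (q.eval (z + 1) - q.eval z) * (q.eval (z + 1) - q.eval z),
      mul_mem_of_nonneg (Int.ediv_nonneg hn0 hz0.le) ?_, ?_, ?_⟩
    · exact_mod_cast increment_mem (q := q.eval) (z := z) one_pos le_rfl
    · linarith [Int.ediv_mul_le n hz0.ne']
    · have := Int.emod_lt_of_pos n hz0
      rw [Int.emod_def, mul_comm] at this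
      linarith
  | succ k hk ih =>
    intro hkD E hE
    obtain ⟨J₀, C₀, hC₀, ih⟩ := ih (by omega) (2 * E) (by positivity)
    obtain ⟨L, hL, hLip⟩ := exists_increment_bound q hq
    obtain ⟨A, hA⟩ : ∃ A : ℤ, A = 2 ^ (k + 1) * (L * (k + 2) * 2 ^ (D - 1)) := ⟨_, rfl⟩
    have hA0 : 0 < A := by rw [hA]; positivity
    obtain ⟨N, hN⟩ : ∃ N : ℤ, N = 4 * A * E := ⟨_, rfl⟩
    have hN0 : 0 < N := by rw [hN]; positivity
    obtain ⟨h, hh⟩ : ∃ h : ℕ, (h : ℤ) = 2 * C₀ * N :=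
      ⟨(2 * C₀ * N).toNat, Int.toNat_of_nonneg (by positivity)⟩
    have hh0 : 0 < (h : ℤ) := by rw [hh]; positivity
    obtain ⟨m, hm⟩ : ∃ m, D = m + k + 1 := ⟨D - k - 1, by omega⟩
    have hdeg := natDegree_iterate_diff_le (h := h) hq (k + 1) hkD
    have hco := pow_le_coeff_iterate_diff (h := h) hh0.le hq hlead (k + 1) hkD
    rw [show D - (k + 1) = m by omega] at hdeg hco ⊢
    rw [show D - k = m + 1 by omega] at ih
    obtain ⟨C', hC', hup⟩ := exists_eval_le _ hdeg
    have hlow := eventually_pow_le_two_mul hdeg hco (by positivity)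
    have hshift : Tendsto (fun z : ℤ => z + 1) atTop atTop :=
      tendsto_atTop_add_const_right atTop 1 tendsto_id
    set J₁ : ℕ := 1 + (k + 1) * h with hJ₁
    have hJh : (J₁ : ℤ) ≤ (k + 2) * h := by rw [hJ₁]; push_cast; linarith
    refine ⟨max J₀ J₁, C' * 2 ^ m, by positivity, ?_⟩
    filter_upwards [ih, hshift.eventually hup, hshift.eventually hlow, eventually_ge_atTop 1,
      eventually_ge_atTop (J₁ : ℤ), eventually_ge_atTop (N * h)] with z ih hup hlow hz1 hzJ hzN n hn
    have hz0 : 0 < z := by linarith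
    have hzD : z ^ D = z * z ^ (D - 1) := by
      rw [← pow_succ', Nat.sub_add_cancel (by omega)]
    have hB : ∀ j ≤ J₁, q.eval (z + j) - q.eval z ≤ L * ((k + 2) * h) * (2 * z) ^ (D - 1) := by
      intro j hj
      have hj' : (j : ℤ) ≤ J₁ := by exact_mod_cast hj
      refine (hLip z j hz0 (by positivity)).trans ?_
      gcongr
      · linarith
      · linarith
    obtain ⟨s, hs, t, ht, hst, -, htB⟩ :=
      exists_mem_sub_eq_iterate_diff q h z _ J₁ hB (k + 1) 1 one_pos le_rfl
    rw [iterate_diff_sub_C, Nat.cast_one] at hst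
    set δ : ℤ := ((diff h)^[k + 1] q).eval (z + 1)
    have hzm : 0 < z ^ m := by positivity
    have hzm1 : z ^ m ≤ (z + 1) ^ m := pow_le_pow_left₀ hz0.le (by linarith) m
    have hδlow : h ^ 2 * z ^ m < 2 * δ := by
      refine lt_of_le_of_lt ?_ hlow
      have : (h : ℤ) ^ 2 ≤ h ^ (k + 1) := pow_le_pow_right₀ (by linarith) (by omega)
      gcongr
    have hδ0 : 0 < δ := by
      have : 0 < (h : ℤ) ^ 2 * z ^ m := by positivity
      linarith
    have hδup : δ ≤ C' * 2 ^ m * z ^ m := by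
      refine hup.trans ?_
      rw [mul_assoc, ← mul_pow]
      gcongr
      linarith
    have htA : t ≤ A * h * z ^ (D - 1) := by
      refine htB.trans (le_of_eq ?_)
      rw [hA, mul_pow]; ring
    have hNh : 0 < N * h := by positivity
    set M : ℤ := z / (N * h) + 1 with hM
    have hM0 : 0 ≤ M := by
      have := Int.ediv_nonneg hz0.le hNh.le
      linarith
    have hMlow : z < N * h * M := by
      have := Int.lt_ediv_add_one_mul_self z hNh
      linarith
    have hMup : N * h * M ≤ 2 * z := by
      have := Int.ediv_mul_le z hNh.ne'
      rw [hM]; linarith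
    -- the reserve `M * t` takes up at most half of `n`
    have hMt : 2 * E * (M * t) ≤ z ^ D := by
      have h1 : M * t ≤ M * (A * h * z ^ (D - 1)) := mul_le_mul_of_nonneg_left htA hM0
      have h2 : 2 * (2 * E * (M * (A * h * z ^ (D - 1)))) = N * h * M * z ^ (D - 1) := by
        rw [hN]; ring
      have h3 : N * h * M * z ^ (D - 1) ≤ 2 * z * z ^ (D - 1) := by gcongr
      have h4 : 2 * E * (M * t) ≤ 2 * E * (M * (A * h * z ^ (D - 1))) := by gcongr
      linarith
    obtain ⟨s₀, hs₀, hr0, hr1⟩ := ih (n - M * t) (by linarith)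
    set r : ℤ := n - M * t - s₀ with hr
    -- and it suffices to correct the error `r`
    have hrM : r ≤ M * δ := by
      have h1 : M * (h ^ 2 * z ^ m) ≤ M * (2 * δ) := mul_le_mul_of_nonneg_left hδlow.le hM0
      have h2 : M * (h ^ 2 * z ^ m) = N * h * M * (2 * C₀ * z ^ m) := by
        rw [pow_two]; nth_rewrite 2 [hh]; ring
      have h3 : z * (2 * C₀ * z ^ m) ≤ N * h * M * (2 * C₀ * z ^ m) := by gcongr
      have h4 : z ^ (m + 1) = z ^ m * z := pow_succ z m
      rw [h4] at hr1
      linarith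
    have hle : r / δ ≤ M := by
      refine le_of_mul_le_mul_right ((Int.ediv_mul_le r hδ0.ne').trans hrM) hδ0
    refine ⟨s₀ + ((M - r / δ) * t + r / δ * s),
      add_mem (incrementMonoid_mono (le_max_left _ _) hs₀) (add_mem
        (mul_mem_of_nonneg (by linarith) (incrementMonoid_mono (le_max_right _ _) ht))
        (mul_mem_of_nonneg (Int.ediv_nonneg hr0 hδ0.le)
          (incrementMonoid_mono (le_max_right _ _) hs))), ?_⟩
    have hrem : n - (s₀ + ((M - r / δ) * t + r / δ * s)) = r % δ := by
      rw [Int.emod_def, ← hst, hr]; ring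
    rw [hrem]
    exact ⟨Int.emod_nonneg _ hδ0.ne', (Int.emod_lt_of_pos _ hδ0).le.trans hδup⟩

/-! ### Monochromatic solutions -/

lemma eventually_mul_lt_eval {q : ℤ[X]} (hdeg : 2 ≤ q.natDegree) (hlead : 0 < q.leadingCoeff)
    (u : ℤ) : ∀ᶠ z : ℤ in atTop, u * z < q.eval z := by
  have h : ∀ᶠ z : ℤ in atTop, 0 < (q - C u * X).eval z := by
    refine eventually_eval_pos (m := q.natDegree) ?_ ?_
    · refine (natDegree_sub_le _ _).trans (max_le le_rfl ?_)
      exact (natDegree_C_mul_le u X).trans (natDegree_X_le.trans (by omega))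
    · rw [coeff_sub, coeff_C_mul, coeff_X_of_ne_one (by omega)]
      simpa using hlead
  filter_upwards [h] with z hz
  simp only [eval_sub, eval_mul, eval_C, eval_X] at hz
  linarith

lemma exists_strictMono_from {q : ℤ[X]} (hdeg : 2 ≤ q.natDegree) (hlead : 0 < q.leadingCoeff) :
    ∃ N : ℤ, ∀ z w : ℤ, N ≤ z → z < w → q.eval z < q.eval w := by
  have hd : q.natDegree ≤ (q.natDegree - 1) + 1 := by omega
  have hpos : ∀ᶠ z : ℤ in atTop, 0 < (diff 1 q).eval z := by
    refine eventually_eval_pos (natDegree_diff_le hd) ?_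
    rw [coeff_diff hd, Nat.sub_add_cancel (by omega)]
    have : 0 < q.coeff q.natDegree := hlead
    positivity
  obtain ⟨N, hN⟩ := eventually_atTop.1 hpos
  refine ⟨N, fun z w hz hzw => ?_⟩
  induction w, Int.add_one_le_iff.2 hzw using Int.leInduction with
  | base => simpa [eval_diff] using hN z hz
  | succ w hw ih =>
    have := hN w (by linarith)
    rw [eval_diff] at this
    linarith [ih (by linarith)]

lemma dvd_eval_of_dvd {q : ℤ[X]} (h0 : q.coeff 0 = 0) {m z : ℤ} (h : m ∣ z) : m ∣ q.eval z := by
  have := sub_dvd_eval_sub z 0 q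
  rw [sub_zero, ← coeff_zero_eq_eval_zero, h0, sub_zero] at this
  exact h.trans this

/-- If `f` and `h` have a period `p`, and `z` is a large multiple of `a b p` within its range, then
`q z` is a sum of two multiples of `p` with the colour of `z`. -/
lemma SolutionFree.false_of_period {q : ℤ[X]} {M : ℤ} {f h c : ℤ → Bool} {a b : ℤ} (ha : 0 < a)
    (hb : 0 < b) (H : SolutionFree q.eval M f h c) (hf : ∀ z, 0 < z → f (a * z) = c z)
    (hh : ∀ z, 0 < z → h (b * z) = c z) (h0 : q.coeff 0 = 0) {R p z : ℤ} (hp : 0 < p)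
    (hper : PeriodicUpTo (fun x => (f x, h x)) R p) (hz : M ≤ z) (hz0 : 0 < z)
    (hpz : a * b * p ∣ z) (hzR : q.eval z ≤ R) (hlarge : (a + b) * z < q.eval z) : False := by
  have hpz' : p ∣ z := (Dvd.intro_left _ rfl).trans hpz
  have hzl : z ≤ a * z := by nlinarith
  have hzb : z ≤ b * z := by nlinarith
  rw [add_mul] at hlarge
  have key : ∀ x, 0 < x → x ≤ R → p ∣ x → f x = c z ∧ h x = c z := by
    intro x hx hxR hpx
    have h1 := hper.eq_of_dvd hp hx (by positivity : 0 < a * z) hxR (by linarith)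
      (dvd_sub (hpz'.mul_left a) hpx)
    have h2 := hper.eq_of_dvd hp hx (by positivity : 0 < b * z) hxR (by linarith)
      (dvd_sub (hpz'.mul_left b) hpx)
    simp only [Prod.mk.injEq] at h1 h2
    exact ⟨h1.1.trans (hf z hz0), h2.2.trans (hh z hz0)⟩
  exact H z (q.eval z - z) z hz0 (by linarith) hz (by ring) (key z hz0 (by linarith) hpz').1
    (key _ (by linarith) (by linarith) (dvd_sub (dvd_eval_of_dvd h0 hpz') hpz')).2

/-- A period `g` which is short against the range `R` forces `c` to be constant. Otherwise some
residue class modulo `g` differs in colour from the class of `0`, and comparing both around `g k`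
yields a period `p` that divides `q (g (k + i)) - q (g k)` for all `i ≤ deg q`. So `p` divides a
constant multiple of `g`, and this constant is nonzero because `q₁ ≠ 0`. As the range of `p` is
about `q (g k)`, this contradicts `false_of_period`. -/
lemma SolutionFree.exists_eq_of_period {q : ℤ[X]} {M : ℤ} {f h c : ℤ → Bool} {a b : ℤ} (ha : 0 < a)
    (hb : 0 < b) (H : SolutionFree q.eval M f h c) (hf : ∀ z, 0 < z → f (a * z) = c z)
    (hh : ∀ z, 0 < z → h (b * z) = c z) (hdeg : 2 ≤ q.natDegree) (hlead : 0 < q.leadingCoeff)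
    (h0 : q.coeff 0 = 0) (h1 : q.coeff 1 ≠ 0) :
    ∃ K : ℤ, 0 < K ∧ ∀ g R : ℤ, 0 < g → K * g ≤ R → PeriodicUpTo f R g →
      ∀ v w, 0 < v → 0 < w → a * v ≤ R → a * w ≤ R → c v = c w := by
  obtain ⟨N₁, hmono⟩ := exists_strictMono_from hdeg hlead
  obtain ⟨N₂, hN₂⟩ := eventually_atTop.1 (eventually_mul_lt_eval hdeg hlead (a + b))
  obtain ⟨A, hA, hinc⟩ := exists_increment_lt_eval q hlead (by omega) 2 two_pos
  obtain ⟨Q, hQ, hdvd⟩ := exists_dvd_coeff_one q.natDegree (by omega)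
  set D := q.natDegree
  set M₁ : ℤ := max (max M 1) (max N₁ N₂) with hM₁
  have hM1 : 1 ≤ M₁ := by omega
  have hD0 : 2 ≤ (D : ℤ) := by exact_mod_cast hdeg
  have hW0 : 0 < |Q * q.coeff 1| := abs_pos.2 (mul_ne_zero hQ h1)
  set W : ℤ := |Q * q.coeff 1| with hW
  obtain ⟨k, hk⟩ : ∃ k : ℤ, k = M₁ + A * D + a * b * M₁ * W + 1 := ⟨_, rfl⟩
  have hAD : A ≤ A * D := by nlinarith
  have hab : 0 < a * b := by positivity
  have hW' : 0 < a * b * M₁ * W := by positivity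
  have hk0 : 0 < k := by rw [hk]; positivity
  refine ⟨a * (k + D), by positivity, fun g R hg hKR hper => ?_⟩
  have hgk : k ≤ g * k := by nlinarith
  have hgkD : a * (g * (k + D)) ≤ R := by
    rw [show a * (g * (k + D)) = a * (k + D) * g by ring]; exact hKR
  have hagk : a * (g * k) ≤ R := by
    refine le_trans ?_ hgkD
    gcongr
    linarith
  suffices hall : ∀ v, 0 < v → a * v ≤ R → c v = c (g * k) from
    fun v w hv hw hvR hwR => (hall v hv hvR).trans (hall w hw hwR).symm
  by_contra! hcon
  obtain ⟨v, hv, hvR, hvc⟩ := hcon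
  -- on the arguments in question, `c` has period `g`
  have hcper : ∀ x y, 0 < x → 0 < y → a * x ≤ R → a * y ≤ R → g ∣ y - x → c x = c y := by
    intro x y hx hy hxR hyR hd
    rw [← hf x hx, ← hf y hy]
    refine hper.eq_of_dvd hg (by positivity) (by positivity) hxR hyR ?_
    rw [← mul_sub]
    exact hd.mul_left a
  set s : ℤ := v % g with hs
  have hs0 : 0 ≤ s := Int.emod_nonneg _ hg.ne'
  have hsg : s < g := Int.emod_lt_of_pos _ hg
  have hgk1 : g * k + g ≤ g * (k + D) := by nlinarith
  have hcw : c (g * k + s) = c v := by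
    refine hcper _ _ (by positivity) hv ?_ hvR ?_
    · refine le_trans ?_ hgkD
      gcongr
      linarith
    · rw [hs, Int.emod_def]
      exact ⟨v / g - k, by ring⟩
  have hs1 : 0 < s := by
    refine lt_of_le_of_ne hs0 fun h => hvc ?_
    rw [← hcw, ← h, add_zero]
  have hMgk : M₁ ≤ g * k := by linarith [mul_nonneg hA.le (by linarith : (0 : ℤ) ≤ D)]
  have hsmall : 2 * (q.eval (g * (k + D)) - q.eval (g * k)) < q.eval (g * k) := by
    have := hinc (g * k) (g * D) (by positivity) (by linarith) ?_
    · rwa [← mul_add] at this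
    · have h2 : g * (A * D) ≤ g * k := by
        gcongr
        linarith
      linarith
  obtain ⟨p, hp0, hpdvd, hpper⟩ := exists_common_period
    (f := fun x => (f x, h x)) (R := q.eval (g * k) - 1)
    (E := q.eval (g * (k + D)) - q.eval (g * k)) (by linarith)
    (fun i : ℕ => q.eval (g * (k + (i + 1 : ℕ))) - q.eval (g * k)) D (by omega) (by
      intro i hi
      have hi' : ((i + 1 : ℕ) : ℤ) ≤ D := by exact_mod_cast hi
      have hi1 : (1 : ℤ) ≤ (i + 1 : ℕ) := by push_cast; linarith [Int.natCast_nonneg i]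
      have hle : g * (k + (i + 1 : ℕ)) ≤ g * (k + D) := by gcongr
      have hge : g * k + g ≤ g * (k + (i + 1 : ℕ)) := by nlinarith
      have hqle : q.eval (g * (k + (i + 1 : ℕ))) ≤ q.eval (g * (k + D)) := by
        rcases hle.eq_or_lt with he | hlt
        · rw [he]
        · exact (hmono _ _ (by omega) hlt).le
      have hqgt : q.eval (g * k) < q.eval (g * (k + (i + 1 : ℕ))) :=
        hmono _ _ (by omega) (by linarith)
      obtain ⟨p, h0, h1, h2, h3⟩ := H.exists_period (z := g * k) (w := g * k + s)
        (z' := g * (k + (i + 1 : ℕ))) (by omega) (by omega) (by omega)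
        (hmono _ _ (by omega) (by linarith)) (hmono _ _ (by omega) (by linarith))
        (hcper _ _ (by positivity) (by positivity) hagk (le_trans (by gcongr) hgkD)
          ⟨(i + 1 : ℕ), by ring⟩)
        (by rw [hcw]; exact fun h => hvc h.symm) (by linarith)
      exact ⟨p, h0, h1.trans (by linarith), h2, h3⟩)
  have hpW : (p : ℤ) ≤ W * g := by
    have h2 : (p : ℤ) ∣ Q * (q.coeff 1 * g) := by
      refine hdvd q le_rfl p g k fun i hi => ?_
      rcases i with _ | i
      · simp
      · exact hpdvd i hi
    have h3 : (p : ℤ) ∣ W * g := by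
      rw [← abs_of_pos hg, hW, ← abs_mul, mul_assoc]
      exact (dvd_abs _ _).2 h2
    exact Int.le_of_dvd (by positivity) h3
  have hp1 : (1 : ℤ) ≤ p := by exact_mod_cast hp0
  have hpab : 1 ≤ a * b * p := by
    have : 0 < a * b * p := by positivity
    linarith
  have hz : M₁ ≤ a * b * p * M₁ := by nlinarith
  have hzk : a * b * p * M₁ < g * k := by
    have h2 : a * b * M₁ * p ≤ a * b * M₁ * (W * g) := by gcongr
    have h3 : a * b * M₁ * W * g < k * g := by
      refine mul_lt_mul_of_pos_right ?_ hg
      linarith [mul_nonneg hA.le (by linarith : (0 : ℤ) ≤ D)]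
    linarith
  have := hmono _ _ (show N₁ ≤ a * b * p * M₁ by omega) hzk
  exact H.false_of_period ha hb hf hh h0 (by linarith) hpper (z := a * b * p * M₁) (by omega)
    (by omega) ⟨M₁, rfl⟩ (by linarith) (hN₂ _ (by omega))

/-- The colouring `c` changes its colour arbitrarily far out. -/
lemma SolutionFree.exists_ne_succ {q : ℤ[X]} {M : ℤ} {f h c : ℤ → Bool} {a b : ℤ} (ha : 0 < a)
    (hb : 0 < b) (H : SolutionFree q.eval M f h c) (hf : ∀ z, 0 < z → f (a * z) = c z)
    (hh : ∀ z, 0 < z → h (b * z) = c z) (hdeg : 2 ≤ q.natDegree) (hlead : 0 < q.leadingCoeff)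
    (h0 : q.coeff 0 = 0) (N : ℤ) : ∃ z, N ≤ z ∧ c z ≠ c (z + 1) := by
  by_contra! hcon
  obtain ⟨N₂, hN₂⟩ := eventually_atTop.1 (eventually_mul_lt_eval hdeg hlead (a + b))
  obtain ⟨n, hn, hnM, hnN, hn₂⟩ : ∃ n : ℤ, 1 ≤ n ∧ M ≤ n ∧ N ≤ n ∧ N₂ ≤ n :=
    ⟨max (max M 1) (max N N₂), by omega, by omega, by omega, by omega⟩
  have hconst : ∀ z, n ≤ z → c z = c n := by
    intro z hz
    induction z, hz using Int.leInduction with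
    | base => rfl
    | succ z hz ih => rw [← hcon z (by linarith), ih]
  have hab : 1 ≤ a * b := by
    have : 0 < a * b := by positivity
    linarith
  have hz : n ≤ a * b * n := by nlinarith
  have hlarge := hN₂ (a * b * n) (by linarith)
  obtain ⟨t, ht⟩ := dvd_eval_of_dvd h0 (Dvd.intro n rfl : a * b ∣ a * b * n)
  have hbn : n ≤ b * n := by nlinarith
  have hat : n ≤ a * (t - n) := by
    have h2 : (2 : ℤ) * (a * b * n) ≤ (a + b) * (a * b * n) := by
      gcongr
      linarith
    have h3 : a * b * (2 * n) < a * b * t := by linarith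
    have h4 : 2 * n < t := lt_of_mul_lt_mul_left h3 (by linarith)
    nlinarith
  refine H (a * (b * n)) (b * (a * (t - n))) (a * b * n) (by positivity)
    (mul_pos hb (by linarith)) (by linarith) ?_ ?_ ?_
  · change _ = q.eval _
    rw [ht]; ring
  · rw [hf _ (by linarith), hconst _ hbn, hconst _ hz]
  · rw [hh _ (by linarith), hconst _ hat, hconst _ hz]

/-- Around a colour change, `c` cannot be constant over a long stretch on both sides: the shifts by
`q (z + j) - q z` preserve the class of `f` with the colour of `z`, and some sum of them leads from
`a (z - i)` to `q z - b (z - j)`. Coprimality of `a` and `b` gives the choice of `i` and `j` that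
makes up for the bounded error of the approximation. -/
lemma SolutionFree.exists_run_bound {q : ℤ[X]} {M : ℤ} {f h c : ℤ → Bool} {a b : ℕ} (ha : 0 < a)
    (hb : 0 < b) (hab : Nat.gcd a b = 1) (H : SolutionFree q.eval M f h c)
    (hf : ∀ z, 0 < z → f (a * z) = c z) (hh : ∀ z, 0 < z → h (b * z) = c z)
    (hdeg : 2 ≤ q.natDegree) (hlead : 0 < q.leadingCoeff) :
    ∃ J : ℕ, ∀ᶠ z : ℤ in atTop, c z ≠ c (z + 1) →
      ∃ i : ℕ, i ≤ J ∧ (c (z - i) ≠ c z ∨ c (z + 1 + i) ≠ c (z + 1)) := by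
  have hlead' : 0 < q.coeff q.natDegree := hlead
  obtain ⟨J₀, C₀, hC₀, hnear⟩ :=
    exists_mem_incrementMonoid_near le_rfl hlead' q.natDegree (by omega) le_rfl 2 two_pos
  obtain ⟨N₁, hmono⟩ := exists_strictMono_from hdeg hlead
  have hbig : ∀ᶠ z : ℤ in atTop, z ^ q.natDegree < 2 * (q.eval z - (a + b) * z) := by
    have h2 : (q - C ((a : ℤ) + b) * X).natDegree ≤ q.natDegree :=
      (natDegree_sub_le _ _).trans (max_le le_rfl
        ((natDegree_C_mul_le _ X).trans (natDegree_X_le.trans (by omega))))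
    have h3 : (1 : ℤ) ≤ (q - C ((a : ℤ) + b) * X).coeff q.natDegree := by
      rw [coeff_sub, coeff_C_mul, coeff_X_of_ne_one (by omega), mul_zero, sub_zero]
      exact hlead'
    filter_upwards [eventually_pow_le_two_mul h2 h3 one_pos] with z hz
    simpa using hz
  set C₁ : ℤ := C₀ + a * b with hC₁
  have hC1 : 0 < C₁ := by positivity
  refine ⟨J₀ + C₁.toNat, ?_⟩
  filter_upwards [hnear, hbig, eventually_ge_atTop M, eventually_ge_atTop N₁,
    eventually_gt_atTop C₁] with z hnear hbig hzM hzN hzC hne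
  by_contra! hcon
  have hleft : ∀ i : ℕ, (i : ℤ) ≤ C₁ → c (z - i) = c z := fun i hi => (hcon i (by omega)).1
  have hright : ∀ j : ℕ, 0 < j → j ≤ J₀ → c (z + j) ≠ c z := by
    intro j hj hjJ
    obtain ⟨i, rfl⟩ : ∃ i, j = i + 1 := ⟨j - 1, by omega⟩
    have := (hcon i (by omega)).2
    rw [show z + 1 + (i : ℤ) = z + (i + 1 : ℕ) by push_cast; ring] at this
    rw [this]
    exact hne.symm
  have hshift : ∀ s ∈ incrementMonoid q.eval J₀ z, 0 ≤ s ∧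
      ∀ x, 0 < x → f x = c z → x + s < q.eval z → f (x + s) = c z := by
    intro s hs
    induction hs using AddSubmonoid.closure_induction with
    | mem s hs =>
      obtain ⟨j, hj, hjJ, rfl⟩ := hs
      have hlt : q.eval z < q.eval (z + j) := hmono _ _ hzN (by omega)
      refine ⟨by linarith, fun x hx hfx hxs => ?_⟩
      have := H.shift (z := z + j) (w := z) (by omega) hzM (hright j hj hjJ) hx (by linarith)
        (by linarith) hfx
      rwa [show x - q.eval z + q.eval (z + j) = x + (q.eval (z + j) - q.eval z) by ring] at this
    | zero => exact ⟨le_rfl, fun x _ hfx _ => by simpa using hfx⟩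
    | add s t _ _ ihs iht =>
      obtain ⟨hs0, hs⟩ := ihs
      obtain ⟨ht0, ht⟩ := iht
      refine ⟨by linarith, fun x hx hfx hxs => ?_⟩
      rw [← add_assoc] at hxs ⊢
      exact ht _ (by linarith) (hs x hx hfx (by linarith)) hxs
  obtain ⟨s, hs, hr0, hr1⟩ := hnear (q.eval z - (a + b) * z + C₁) (by linarith)
  rw [Nat.sub_self, pow_zero, mul_one] at hr1
  -- `u` is what is left for `a * i + b * j`
  obtain ⟨u, hu⟩ : ∃ u : ℕ, (u : ℤ) = (a + b) * z - (q.eval z - s) :=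
    ⟨((a + b) * z - (q.eval z - s)).toNat, Int.toNat_of_nonneg (by nlinarith)⟩
  have huab : a * b ≤ u := by
    have : (a : ℤ) * b ≤ u := by rw [hu]; linarith
    exact_mod_cast this
  have huC : (u : ℤ) ≤ C₁ := by rw [hu]; linarith
  obtain ⟨i, j, hij⟩ := Nat.exists_add_mul_eq_of_gcd_dvd_of_mul_pred_le a b u (by simp [hab])
    ((Nat.mul_le_mul a.pred_le b.pred_le).trans huab)
  have hi : i ≤ u := by nlinarith [Nat.zero_le (j * b), Nat.le_mul_of_pos_right i ha]
  have hj : j ≤ u := by nlinarith [Nat.zero_le (i * a), Nat.le_mul_of_pos_right j hb]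
  have hi' : (i : ℤ) ≤ C₁ := by omega
  have hj' : (j : ℤ) ≤ C₁ := by omega
  have hij' : (i : ℤ) * a + j * b = u := by exact_mod_cast hij
  have hai : 0 < (a : ℤ) * (z - i) := mul_pos (by exact_mod_cast ha) (by linarith)
  have hbj : 0 < (b : ℤ) * (z - j) := mul_pos (by exact_mod_cast hb) (by linarith)
  obtain ⟨hs0, hmove⟩ := hshift s hs
  have hsum : (a : ℤ) * (z - i) + s = q.eval z - b * (z - j) := by linarith
  have hfx := hmove (a * (z - i)) hai (by rw [hf _ (by linarith), hleft i hi']) (by linarith)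
  exact H (a * (z - i) + s) (b * (z - j)) z (by linarith) hbj hzM (by linarith) hfx
    (by rw [hh _ (by linarith), hleft j hj'])

/-- No colouring is free of solutions: colour changes back and forth occur within a bounded
distance arbitrarily far out, they produce a period that is short against its range, and this is
impossible by `exists_eq_of_period`. -/
lemma not_solutionFree {q : ℤ[X]} {M : ℤ} {f h c : ℤ → Bool} {a b : ℕ} (ha : 0 < a)
    (hb : 0 < b) (hab : Nat.gcd a b = 1) (hf : ∀ z, 0 < z → f (a * z) = c z)
    (hh : ∀ z, 0 < z → h (b * z) = c z) (hdeg : 2 ≤ q.natDegree) (hlead : 0 < q.leadingCoeff)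
    (h0 : q.coeff 0 = 0) (h1 : q.coeff 1 ≠ 0) : ¬ SolutionFree q.eval M f h c := by
  intro H
  have ha' : (0 : ℤ) < a := by exact_mod_cast ha
  have hb' : (0 : ℤ) < b := by exact_mod_cast hb
  obtain ⟨K, hK, hconst⟩ := H.exists_eq_of_period ha' hb' hf hh hdeg hlead h0 h1
  obtain ⟨J, hJ⟩ := H.exists_run_bound ha hb hab hf hh hdeg hlead
  obtain ⟨A, hA, hinc⟩ := exists_increment_lt_eval q hlead (by omega) K hK
  obtain ⟨A', hA', hinc'⟩ := exists_increment_lt_eval q hlead (by omega) 1 one_pos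
  obtain ⟨N₁, hmono⟩ := exists_strictMono_from hdeg hlead
  obtain ⟨N₂, hN₂⟩ := eventually_atTop.1 (eventually_mul_lt_eval hdeg hlead (2 * a))
  obtain ⟨N₃, hN₃⟩ := eventually_atTop.1 hJ
  obtain ⟨B, hB0, hBA, hBA'⟩ : ∃ B : ℤ, 0 ≤ B ∧ A * (1 + (J + 1)) ≤ B ∧ A' * (1 + (J + 1)) ≤ B :=
    ⟨max (A * (1 + (J + 1))) (A' * (1 + (J + 1))), by positivity, le_max_left _ _, le_max_right _ _⟩
  obtain ⟨N, hN⟩ : ∃ N : ℤ, N = max (max M N₁) (max N₂ N₃) := ⟨_, rfl⟩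
  obtain ⟨t, ht, hct⟩ :=
    H.exists_ne_succ ha' hb' hf hh hdeg hlead h0 (max N 0 + B + 2 * J + 3)
  obtain ⟨i, hiJ, hi⟩ := hN₃ t (by omega) hct
  have hiJ' : (i : ℤ) ≤ J := by exact_mod_cast hiJ
  obtain ⟨z, w, z', hz, hzw, hwz', hz', hc, hcw⟩ : ∃ z w z' : ℤ, max N 0 + B + J + 3 ≤ z ∧
      z < w ∧ w < z' ∧ z' ≤ z + (1 + (J + 1)) ∧ c z = c z' ∧ c z ≠ c w := by
    rcases hi with hi | hi
    · have hi0 : i ≠ 0 := by rintro rfl; simp at hi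
      refine ⟨t - i, t, t + 1, by omega, by omega, by omega, by omega, ?_, hi⟩
      revert hi hct
      cases c (t - i) <;> cases c t <;> cases c (t + 1) <;> simp
    · have hi0 : i ≠ 0 := by rintro rfl; simp at hi
      refine ⟨t, t + 1, t + 1 + i, by omega, by omega, by omega, by omega, ?_, hct⟩
      revert hi hct
      cases c (t + 1 + i) <;> cases c t <;> cases c (t + 1) <;> simp
  have hJ0 : (0 : ℤ) ≤ J := by positivity
  have hBz : B ≤ z := by omega
  have hz0 : 0 < z := by omega
  obtain ⟨m, rfl⟩ : ∃ m, z' = z + m := ⟨z' - z, by ring⟩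
  have hm : m ≤ 1 + (J + 1) := by linarith
  have hAm : A * m ≤ A * (1 + (J + 1)) := by gcongr
  have hAm' : A' * m ≤ A' * (1 + (J + 1)) := by gcongr
  have hAB : A ≤ A * (1 + (J + 1)) := by nlinarith
  have hAB' : A' ≤ A' * (1 + (J + 1)) := by nlinarith
  have hq := hinc z m (by linarith) (by linarith) (by linarith)
  have hq' := hinc' z m (by linarith) (by linarith) (by linarith)
  obtain ⟨p, hp0, hple, -, hper⟩ := H.exists_period (z := z) (w := w) (z' := z + m) (by omega)
    (by omega) (by omega) (hmono _ _ (by omega) hzw) (hmono _ _ (by omega) hwz') hc hcw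
    (by linarith)
  have hKp : K * p ≤ q.eval z - 1 := by
    have : K * p ≤ K * (q.eval (z + m) - q.eval z) := by gcongr
    linarith
  have hqz := hN₂ z (by omega)
  have haw : (a : ℤ) * w ≤ a * (2 * z) := by
    gcongr
    omega
  have haz : (a : ℤ) * z ≤ a * (2 * z) := by
    gcongr
    omega
  exact hcw (hconst p (q.eval z - 1) (by exact_mod_cast hp0) hKp
    (fun x hx hxR => (Prod.ext_iff.1 (hper x hx hxR)).1) z w hz0 (by linarith) (by linarith)
    (by linarith))

/-! ### Reduction to equal coefficients -/

/-- The polynomial `q z = p (n z) / n`; the division is exact because `p` has no constant term, and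
it leaves the linear coefficient unchanged. -/
lemma exists_rescaled_polynomial {p : ℤ[X]} (hdeg : 2 ≤ p.natDegree) (hlead : 0 < p.leadingCoeff)
    (h0 : p.coeff 0 = 0) (h1 : p.coeff 1 ≠ 0) {n : ℤ} (hn : 0 < n) :
    ∃ q : ℤ[X], 2 ≤ q.natDegree ∧ 0 < q.leadingCoeff ∧ q.coeff 0 = 0 ∧ q.coeff 1 ≠ 0 ∧
      ∀ z : ℤ, p.eval (n * z) = n * q.eval z := by
  have hdivX : p.divX.natDegree + 1 = p.natDegree := by
    rw [natDegree_divX_eq_natDegree_tsub_one]; omega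
  have hr : (p.divX.comp (C n * X)).natDegree = p.divX.natDegree := by
    rw [natDegree_comp, natDegree_C_mul_X _ hn.ne', mul_one]
  have hr0 : 0 < (p.divX.comp (C n * X)).leadingCoeff := by
    have : p.divX.leadingCoeff = p.leadingCoeff := by
      rw [leadingCoeff, coeff_divX, hdivX, leadingCoeff]
    rw [leadingCoeff_comp (by rw [natDegree_C_mul_X _ hn.ne']; exact one_ne_zero),
      leadingCoeff_C_mul_X, this]
    positivity
  refine ⟨p.divX.comp (C n * X) * X, ?_, ?_, ?_, ?_, fun z => ?_⟩
  · rwa [natDegree_mul_X (leadingCoeff_ne_zero.1 hr0.ne'), hr, hdivX]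
  · rwa [leadingCoeff_mul_X]
  · rw [coeff_mul_X_zero]
  · rw [coeff_mul_X, comp_C_mul_X_coeff, coeff_divX]
    simpa using h1
  · have hX : p = p.divX * X := by
      conv_lhs => rw [← divX_mul_X_add p, h0, C_0, add_zero]
    conv_lhs => rw [hX]
    simp only [eval_mul, eval_comp, eval_C, eval_X]
    ring

end LinearPolynomialRamsey

theorem theorem1 (a b : ℕ) (ha : 0 < a) (hb : 0 < b) (hab : Nat.gcd a b = 1)
    (p : Polynomial ℤ) (hdeg : 2 ≤ p.natDegree) (hlead : 0 < p.leadingCoeff)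
    (h0 : p.coeff 0 = 0) (h1 : p.coeff 1 ≠ 0) :
    IsRamseyEquation 2 a b p := by
  intro φ hfin
  have hab' : (0 : ℤ) < a * b := by positivity
  obtain ⟨q, hq, hqlead, hq0, hq1, hqeval⟩ :=
    LinearPolynomialRamsey.exists_rescaled_polynomial hdeg hlead h0 h1 hab'
  -- finitely many solutions have bounded `z`
  obtain ⟨M, hM⟩ : ∃ M : ℕ, ∀ s ∈ {s : ℕ+ × ℕ+ × ℕ+ |
      (a : ℤ) * (s.1 : ℤ) + (b : ℤ) * (s.2.1 : ℤ) = p.eval (s.2.2 : ℤ) ∧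
        φ s.1 = φ s.2.1 ∧ φ s.2.1 = φ s.2.2}, (s.2.2 : ℕ) ≤ M := by
    obtain ⟨M, hM⟩ := (hfin.image fun s => (s.2.2 : ℕ)).bddAbove
    exact ⟨M, fun s hs => hM ⟨s, hs, rfl⟩⟩
  -- the colouring, extended to all integers by an irrelevant value
  let ψ : ℤ → Bool := fun n => if hn : 0 < n then decide (φ ⟨n.toNat, by omega⟩ = 0) else false
  have hψ : ∀ m n : ℕ+, ψ m = ψ n → φ m = φ n := by
    intro m n h
    simp only [ψ, Int.natCast_pos, PNat.pos, dite_true, Int.toNat_natCast,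
      decide_eq_decide] at h
    change φ m = 0 ↔ φ n = 0 at h
    rw [Fin.ext_iff, Fin.ext_iff] at h
    rw [Fin.ext_iff]
    simp only [Fin.val_zero] at h
    omega
  -- a solution of `x + y = q z` gives the solution `(b x, a y, a b z)` of the given equation
  refine LinearPolynomialRamsey.not_solutionFree (q := q) (M := M + 1) (f := fun x => ψ (b * x))
    (h := fun y => ψ (a * y)) (c := fun z => ψ (a * b * z)) ha hb hab ?_ ?_ hq hqlead hq0 hq1 ?_
  · intro z _
    simp only [mul_left_comm, mul_assoc]
  · intro z _
    simp only [mul_assoc]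
  · intro x y z hx hy hz hxyz hfx hhy
    have hz0 : 0 < z := by omega
    lift x to ℕ using hx.le
    lift y to ℕ using hy.le
    lift z to ℕ using hz0.le
    norm_cast at hx hy hz0
    let u : ℕ+ := ⟨b * x, by positivity⟩
    let v : ℕ+ := ⟨a * y, by positivity⟩
    let w : ℕ+ := ⟨a * b * z, by positivity⟩
    have hu : ((u : ℕ) : ℤ) = b * x := by simp [u]
    have hv : ((v : ℕ) : ℤ) = a * y := by simp [v]
    have hw : ((w : ℕ) : ℤ) = a * b * z := by simp [w]
    have huw : φ u = φ w := hψ _ _ (by rw [hu, hw]; exact hfx)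
    have hvw : φ v = φ w := hψ _ _ (by rw [hv, hw]; exact hhy)
    have hle := hM (u, v, w) ⟨by
      simp only [hu, hv, hw, hqeval, ← hxyz]; ring, huw.trans hvw.symm, hvw⟩
    have hzw : z ≤ a * b * z := Nat.le_mul_of_pos_left z (by positivity)
    have hwM : a * b * z ≤ M := hle
    omega
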